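/- **Corollary 2.13.** The Nakayama conjecture holds for Terwilliger algebras of quasi-thin schemes over any field. Precisely: let $k$ be a field, $X$ a nonempty finite set, and $S=\{R_0,\dots,R_d\}$ an association scheme on $X$, that is, a partition of $X\times X$ into nonempty parts such that $R_0=\{(y,y)\mid y\in X\}$; for each $i$ there is $i'$ with $R_{i'}=\{(y,z)\mid (z,y)\in R_i\}$; and for all $i,j,\ell$ the number $p_{ij}^{\ell}=|\{w\in X\mid (y,w)\in R_i,\ (w,z)\in R_j\}|$ is the same for all $(y,z)\in R_\ell$. Assume that $S$ is quasi-thin: every valency $k_i=p_{ii'}^{0}$ is at most $2$. Let $x\in X$, and let $\mathcal T$ be the Terwilliger algebra of $S$ over $k$ with respect to $x$, that is, the unital $k$-subalgebra of the matrix algebra $M_X(k)$ generated by the adjacency matrices $A_i=\sum_{(y,z)\in R_i}E_{yz}$ and the dual idempotents $E_i^*(x)=\sum_{y:\,(x,y)\in R_i}E_{yy}$ for $0\le i\le d$, where $E_{yz}$ are the matrix units. If $\mathcal T$ has infinite dominant dimension, that is, if all terms $I_n$, $n\ge 0$, of a minimal injective resolution $0\to{}_{\mathcal T}\mathcal T\to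 I_0\to I_1\to\cdots$ are projective, then $\mathcal T$ is self-injective (the left module ${}_{\mathcal T}\mathcal T$ is injective); in fact, $\mathcal T$ is semisimple. -/

import Mathlib

/-- An association scheme `{R 0, ..., R d}` on `X`: a partition of `X × X` into nonempty parts.
(`X` is automatically nonempty, because the part `R 0` is.) -/
structure AssociationScheme (X : Type*) (d : ℕ) where
  /-- the relations of the scheme -/
  R : Fin (d + 1) → Set (X × X)
  nonempty : ∀ i, (R i).Nonempty
  partition : ∀ q : X × X, ∃! i, q ∈ R i
  diag : R 0 = {q | q.1 = q.2}
  transpose : ∀ i, ∃ i', R i' = {q | (q.2, q.1) ∈ R i}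
  regular : ∀ i j l : Fin (d + 1), ∀ x y u v : X, (x, y) ∈ R l → (u, v) ∈ R l →
    {z | (x, z) ∈ R i ∧ (z, y) ∈ R j}.ncard = {w | (u, w) ∈ R i ∧ (w, v) ∈ R j}.ncard

namespace AssociationScheme

variable {X : Type*} {d : ℕ} (S : AssociationScheme X d)

/-- The index `i'` of the transposed relation. -/
noncomputable def inv (i : Fin (d + 1)) : Fin (d + 1) := (S.transpose i).choose

theorem mem_R_inv (i : Fin (d + 1)) (x y : X) : (x, y) ∈ S.R (S.inv i) ↔ (y, x) ∈ S.R i := by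
  have h := (S.transpose i).choose_spec
  change (x, y) ∈ S.R (S.transpose i).choose ↔ _
  rw [h]
  rfl

/-- The intersection number `p_{ij}^l`, computed at some pair of `R l`. -/
noncomputable def intersectionNumber (i j l : Fin (d + 1)) : ℕ :=
  {z | ((S.nonempty l).some.1, z) ∈ S.R i ∧ (z, (S.nonempty l).some.2) ∈ S.R j}.ncard

/-- The intersection number does not depend on the pair of `R l`. -/
theorem intersectionNumber_eq {i j l : Fin (d + 1)} {x y : X} (h : (x, y) ∈ S.R l) :
    S.intersectionNumber i j l = {z | (x, z) ∈ S.R i ∧ (z, y) ∈ S.R j}.ncard :=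
  S.regular i j l _ _ x y (S.nonempty l).some_mem h

/-- The valency `k_i = p_{i i'}^0` of the relation `R i`. -/
noncomputable def valency (i : Fin (d + 1)) : ℕ := S.intersectionNumber i (S.inv i) 0

/-- The valency of `R i` is the cardinality of `x R_i` for every vertex `x`. -/
theorem valency_eq (i : Fin (d + 1)) (x : X) : S.valency i = {y | (x, y) ∈ S.R i}.ncard := by
  have h : (x, x) ∈ S.R 0 := by rw [S.diag]; rfl
  rw [valency, S.intersectionNumber_eq h]
  simp only [mem_R_inv, and_self]

/-- A scheme is quasi-thin if all its valencies are at most `2`. -/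
def IsQuasiThin : Prop := ∀ i, S.valency i ≤ 2

variable (k : Type*) [Field k]

open Classical in
/-- The adjacency matrix `A_i` of the relation `R i`. -/
noncomputable def adjacencyMatrix (i : Fin (d + 1)) : Matrix X X k :=
  Matrix.of fun y z => if (y, z) ∈ S.R i then 1 else 0

open Classical in
/-- The dual idempotent `E_i^*(x)`: the sum of the matrix units `E_{yy}` with `(x, y) ∈ R i`. -/
noncomputable def dualIdempotent [DecidableEq X] (x : X) (i : Fin (d + 1)) : Matrix X X k :=
  Matrix.diagonal fun y => if (x, y) ∈ S.R i then 1 else 0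

/-- The Terwilliger algebra of `S` over `k` with respect to the vertex `x`: the (unital)
subalgebra of the matrix algebra generated by the adjacency matrices and dual idempotents. -/
noncomputable def terwilligerAlgebra [Fintype X] [DecidableEq X] (x : X) :
    Subalgebra k (Matrix X X k) :=
  Algebra.adjoin k (Set.range (S.adjacencyMatrix k) ∪ Set.range (S.dualIdempotent k x))

end AssociationScheme

/-- A submodule `N` of `M` is essential if it meets every nonzero submodule nontrivially. -/
def IsEssentialSubmodule {A M : Type*} [Ring A] [AddCommGroup M] [Module A M]
    (N : Submodule A M) : Prop :=
  ∀ L : Submodule A M, L ⊓ N = ⊥ → L = ⊥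

universe u

/-- A minimal injective resolution `0 → M → I 0 → I 1 → ⋯` of the left `A`-module `M`: an exact
sequence with all `I n` injective, in which the image of each map is essential in its target
(so that each `I n` is an injective hull of the corresponding cosyzygy of `M`). -/
structure MinimalInjectiveResolution (A : Type u) [Ring A] (M : Type u) [AddCommGroup M]
    [Module A M] where
  /-- the terms of the resolution -/
  I : ℕ → Type u
  [addCommGroup : ∀ n, AddCommGroup (I n)]
  [module : ∀ n, Module A (I n)]
  /-- the augmentation -/
  ι : M →ₗ[A] I 0
  /-- the differentials -/
  δ : ∀ n, I n →ₗ[A] I (n + 1)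
  injective : ∀ n, Module.Injective A (I n)
  ι_injective : Function.Injective ι
  exact_zero : Function.Exact ι (δ 0)
  exact_succ : ∀ n, Function.Exact (δ n) (δ (n + 1))
  essential_zero : IsEssentialSubmodule (LinearMap.range ι)
  essential_succ : ∀ n, IsEssentialSubmodule (LinearMap.range (δ n))

attribute [instance] MinimalInjectiveResolution.addCommGroup MinimalInjectiveResolution.module

/-- The least `n` such that the `n`-th term of the resolution `P` is not projective, and `⊤` if
all terms are projective. -/
noncomputable def MinimalInjectiveResolution.firstNonprojective {A : Type u} [Ring A] {M : Type u}
    [AddCommGroup M] [Module A M] (P : MinimalInjectiveResolution A M) : ℕ∞ :=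
  ⨅ (n : ℕ) (_ : ¬ Module.Projective A (P.I n)), (n : ℕ∞)

/-- The dominant dimension of `A`: the least `n` such that the `n`-th term of a minimal injective
resolution of the left regular module is not projective, and `⊤` if there is no such `n`.
Minimal injective resolutions exist and are unique up to isomorphism, so that all members of the
supremum are equal. -/
noncomputable def dominantDimension (A : Type u) [Ring A] : ℕ∞ :=
  ⨆ P : MinimalInjectiveResolution A A, P.firstNonprojective

/-! As valencies are at most 2, exchanging the points of each two-point class xR_i and fixing the
other points gives an involution τ (`swap`). It is a scheme automorphism fixing x
(`color_swap_swap`), so all matrices in 𝒯 are τ-invariant; the permutation matrix of τ also lies in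
𝒯. If 2 ≠ 0 in k or τ = 1, split a radical element into τ-eigenparts. A block N of an eigenpart, cut
out by two classes, has entries ±c, so the nilpotent NᵀN has trace c² times the two class sizes.
Hence c = 0, and 𝒯 is semisimple. If 2 = 0 and τ moves p, let a be the indicator of the class of p
placed in column x, and b = aᵀ. Then ba = 0, and a chase through the resolution
(`not_projective_two`) shows that I₂ is not projective. -/

/-! ### Annihilators and the third term of an injective resolution -/

section Chase

variable {A : Type u} [Ring A]

/-- The map `y * a ↦ y • m` is well defined on the left ideal generated by `a`, realised as a
quotient of `A`. It extends to `A`, and `v` is the image of `1`. -/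
theorem Module.Injective.exists_smul_eq {N : Type u} [AddCommGroup N] [Module A N]
    (hN : Module.Injective A N) {a : A} {m : N} (h : ∀ y : A, y * a = 0 → y • m = 0) :
    ∃ v : N, a • v = m := by
  let φ : A →ₗ[A] A := LinearMap.toSpanSingleton A A a
  let ψ : A →ₗ[A] N := LinearMap.toSpanSingleton A N m
  have hker : LinearMap.ker φ ≤ LinearMap.ker ψ := by
    intro y hy
    simp only [φ, ψ, LinearMap.mem_ker, LinearMap.toSpanSingleton_apply, smul_eq_mul] at hy ⊢
    exact h y hy
  obtain ⟨g, hg⟩ := hN.out ((LinearMap.ker φ).liftQ φ le_rfl)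
    (LinearMap.ker_eq_bot.mp (Submodule.ker_liftQ_eq_bot _ _ _ le_rfl))
    ((LinearMap.ker φ).liftQ ψ hker)
  refine ⟨g 1, ?_⟩
  have := hg ((LinearMap.ker φ).mkQ 1)
  simp only [Submodule.mkQ_apply, Submodule.liftQ_apply, φ, ψ,
    LinearMap.toSpanSingleton_apply, one_smul] at this
  rw [← map_smul, smul_eq_mul, mul_one, this]

/-- A projective module embeds in a free one, where the claim is checked coordinatewise. -/
theorem Module.Projective.smul_eq_zero_of_forall {N : Type u} [AddCommGroup N] [Module A N]
    (hN : Module.Projective A N) {a e : A} (h : ∀ y : A, a * y = 0 → e * y = 0) {n : N}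
    (hn : a • n = 0) : e • n = 0 := by
  obtain ⟨s, hs⟩ := hN.out
  apply hs.injective
  rw [map_smul, map_zero]
  ext i
  have := DFunLike.congr_fun (congrArg s hn) i
  rw [map_smul, map_zero] at this
  exact h _ this

/-- Divide `ι e` by `b` in `I 0` (`h₁`), then `δ (f • u)` by `a` in `I 1` (`h₂`). If `I 2` were
projective, `h₃` would lift `e • v` to some `w` in `I 0`. Then `f • u - a • w` comes from some `s`
in `A`, and multiplying by `b` gives `b * s = e`. -/
theorem MinimalInjectiveResolution.not_projective_two {e f a b : A} (hae : a * e = a)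
    (hbf : b * f = b) (hba : b * a = 0) (h₁ : ∀ y : A, y * b = 0 → y * e = 0)
    (h₂ : ∀ y : A, y * a = 0 → ∃ z, y * f = z * b) (h₃ : ∀ y : A, a * y = 0 → e * y = 0)
    (h₄ : ∀ s : A, b * s ≠ e) (P : MinimalInjectiveResolution A A) :
    ¬ Module.Projective A (P.I 2) := by
  intro hP
  have hδ (n : ℕ) (y : P.I n) : P.δ (n + 1) (P.δ n y) = 0 := (P.exact_succ n).apply_apply_eq_zero y
  obtain ⟨u, hu⟩ : ∃ u : P.I 0, b • u = P.ι e := by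
    refine (P.injective 0).exists_smul_eq fun y hy => ?_
    rw [← map_smul, smul_eq_mul, h₁ y hy, map_zero]
  obtain ⟨v, hv⟩ : ∃ v : P.I 1, a • v = P.δ 0 (f • u) := by
    refine (P.injective 1).exists_smul_eq fun y hy => ?_
    obtain ⟨z, hz⟩ := h₂ y hy
    rw [← map_smul, smul_smul, hz, mul_smul, hu, map_smul, P.exact_zero.apply_apply_eq_zero,
      smul_zero]
  have hv2 : e • P.δ 1 v = 0 := by
    refine hP.smul_eq_zero_of_forall h₃ ?_
    rw [← map_smul, hv, hδ]
  rw [← map_smul] at hv2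
  obtain ⟨w, hw⟩ := (P.exact_succ 0 _).mp hv2
  obtain ⟨s, hs⟩ : ∃ s, P.ι s = f • u - a • w := by
    refine (P.exact_zero _).mp ?_
    rw [map_sub, ← hv, map_smul, hw, smul_smul, hae, sub_self]
  refine h₄ s (P.ι_injective ?_)
  rw [← smul_eq_mul, map_smul, hs, smul_sub, smul_smul, smul_smul, hbf, hba, zero_smul, sub_zero,
    hu]

theorem dominantDimension_ne_top
    (h : ∀ P : MinimalInjectiveResolution A A, ¬ Module.Projective A (P.I 2)) :
    dominantDimension A ≠ ⊤ := by
  refine ne_top_of_le_ne_top (ENat.natCast_ne_top 2) (iSup_le fun P => ?_)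
  exact iInf₂_le 2 (h P)

end Chase

/-! ### The involution of a quasi-thin scheme -/

namespace AssociationScheme

section Swap

variable {X : Type*} {d : ℕ} (S : AssociationScheme X d) (x : X)

/-- The index of the relation that contains `(y, z)`. -/
noncomputable def color (y z : X) : Fin (d + 1) := (S.partition (y, z)).choose

theorem mem_R_iff (i : Fin (d + 1)) (y z : X) : (y, z) ∈ S.R i ↔ S.color y z = i := by
  have h := (S.partition (y, z)).choose_spec
  exact ⟨fun hi => (h.2 i hi).symm, fun hi => hi ▸ h.1⟩

theorem color_eq_zero_iff (y z : X) : S.color y z = 0 ↔ y = z := by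
  rw [← mem_R_iff, S.diag]; rfl

theorem color_eq_inv_iff (i : Fin (d + 1)) (y z : X) :
    S.color y z = S.inv i ↔ S.color z y = i := by
  rw [← mem_R_iff, ← mem_R_iff, mem_R_inv]

theorem color_swap {y z u v : X} (h : S.color y z = S.color u v) : S.color z y = S.color v u := by
  rw [← S.color_eq_inv_iff, h, S.color_eq_inv_iff]

theorem ncard_color_eq {y z u v : X} (h : S.color y z = S.color u v) (i j : Fin (d + 1)) :
    {w | S.color y w = i ∧ S.color w z = j}.ncard =
      {w | S.color u w = i ∧ S.color w v = j}.ncard := by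
  simpa only [mem_R_iff] using
    S.regular i j _ y z u v ((S.mem_R_iff _ _ _).mpr h) ((S.mem_R_iff _ _ _).mpr rfl)

open Classical in
/-- The other point of the `R i`-neighbourhood of `x` that contains `y`, if there is one, and `y`
otherwise. -/
noncomputable def swap (y : X) : X :=
  if h : ∃ z, S.color x z = S.color x y ∧ z ≠ y then h.choose else y

theorem color_swap_right (y : X) : S.color x (S.swap x y) = S.color x y := by
  unfold swap
  split_ifs with h
  exacts [h.choose_spec.1, rfl]

theorem IsQuasiThin.eq_or_eq_swap {S : AssociationScheme X d} [Finite X] (hS : S.IsQuasiThin)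
    {x y z : X} (h : S.color x z = S.color x y) : z = y ∨ z = S.swap x y := by
  by_contra! hne
  have hex : ∃ z, S.color x z = S.color x y ∧ z ≠ y := ⟨z, h, hne.1⟩
  have hsw : S.swap x y ≠ y := by
    rw [swap, dif_pos hex]; exact hex.choose_spec.2
  have h3 : ({z, y, S.swap x y} : Set X).ncard = 3 := Set.ncard_eq_three.mpr
    ⟨z, y, S.swap x y, hne.1, hne.2, hsw.symm, rfl⟩
  have hle := hS (S.color x y)
  rw [S.valency_eq _ x] at hle
  have : ({z, y, S.swap x y} : Set X).ncard ≤ {w | (x, w) ∈ S.R (S.color x y)}.ncard := by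
    refine Set.ncard_le_ncard ?_ (Set.toFinite _)
    rintro w (rfl | rfl | rfl)
    · exact (S.mem_R_iff _ _ _).mpr h
    · exact (S.mem_R_iff _ _ _).mpr rfl
    · exact (S.mem_R_iff _ _ _).mpr (S.color_swap_right x y)
  omega

theorem IsQuasiThin.color_eq_iff {S : AssociationScheme X d} [Finite X] (hS : S.IsQuasiThin)
    {x y z : X} : S.color x z = S.color x y ↔ z = y ∨ z = S.swap x y := by
  refine ⟨hS.eq_or_eq_swap, ?_⟩
  rintro (rfl | rfl)
  exacts [rfl, S.color_swap_right x y]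

theorem IsQuasiThin.swap_swap {S : AssociationScheme X d} [Finite X] (hS : S.IsQuasiThin)
    (x y : X) : S.swap x (S.swap x y) = y := by
  rcases hS.eq_or_eq_swap (S.color_swap_right x y).symm with h | h
  · rw [← h, ← h]
  · exact h.symm

theorem swap_self (x : X) : S.swap x x = x := by
  have := S.color_swap_right x x
  rw [(S.color_eq_zero_iff x x).mpr rfl, color_eq_zero_iff] at this
  exact this.symm

/-- Regularity, applied to `(x, z)` and `(x, swap x z)`, gives a point in the class of `y` with
color `l` to `swap x z`. If it is `swap x y`, this is the claim. -/
theorem IsQuasiThin.color_swap_swap {S : AssociationScheme X d} [Finite X] (hS : S.IsQuasiThin)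
    (x y z : X) : S.color (S.swap x y) (S.swap x z) = S.color y z := by
  set l := S.color y z with hl
  have hpos : {w | S.color x w = S.color x y ∧ S.color w z = l}.ncard ≠ 0 :=
    Set.ncard_ne_zero_of_mem (a := y) ⟨rfl, rfl⟩
  rw [S.ncard_color_eq (S.color_swap_right x z).symm] at hpos
  obtain ⟨u, hu, hul⟩ := Set.nonempty_of_ncard_ne_zero hpos
  rcases hS.eq_or_eq_swap hu with rfl | rfl
  swap
  · exact hul
  -- Otherwise `y`, now `u`, sees the whole class of `z` in color `l`. By regularity so does `swap x
  -- u`.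
  have hcard : ({w | S.color u w = l ∧ S.color w x = S.color z x} : Set X) =
      {w | S.color x w = S.color x z} := by
    ext w
    refine ⟨fun h => S.color_swap h.2, fun h => ⟨?_, S.color_swap h⟩⟩
    rcases hS.eq_or_eq_swap h with rfl | rfl
    exacts [rfl, hul]
  have hn := S.ncard_color_eq (S.color_swap (S.color_swap_right x u)) l (S.color z x)
  rw [hcard] at hn
  have hsub : {w | S.color (S.swap x u) w = l ∧ S.color w x = S.color z x} ⊆
      {w | S.color x w = S.color x z} := fun w h => S.color_swap h.2
  have heq := Set.eq_of_subset_of_ncard_le hsub hn.ge (Set.toFinite _)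
  have : S.swap x z ∈ {w | S.color (S.swap x u) w = l ∧ S.color w x = S.color z x} := by
    rw [heq]; exact S.color_swap_right x z
  exact this.1

/-- Hence a single adjacency matrix, cut down to the class of `p`, is the swap matrix of that class.
-/
theorem IsQuasiThin.color_self_swap_iff {S : AssociationScheme X d} [Finite X]
    (hS : S.IsQuasiThin) {x p y z : X} (hy : S.color x y = S.color x p)
    (hz : S.color x z = S.color x p) :
    S.color y z = S.color p (S.swap x p) ↔ z = S.swap x y := by
  have hself (w : X) : S.color w w = 0 := (S.color_eq_zero_iff w w).mpr rfl
  have hps := hS.color_swap_swap x p (S.swap x p)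
  rw [hS.swap_swap] at hps
  rcases hS.eq_or_eq_swap hy with rfl | rfl <;> rcases hS.eq_or_eq_swap hz with rfl | rfl
  · rw [hself, eq_comm, color_eq_zero_iff]
  · simp
  · simp [hps, hS.swap_swap]
  · rw [hself, eq_comm, color_eq_zero_iff, hS.swap_swap, eq_comm]

end Swap
end AssociationScheme

/-! ### Invariant matrices in the Terwilliger algebra -/

namespace AssociationScheme

section Terwilliger

variable {X : Type*} {d : ℕ} (S : AssociationScheme X d) (k : Type*) [Field k]
  (x : X)

theorem adjacencyMatrix_apply (i : Fin (d + 1)) (y z : X) :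
    S.adjacencyMatrix k i y z = if S.color y z = i then 1 else 0 := by
  simp only [adjacencyMatrix, Matrix.of_apply, mem_R_iff]

theorem dualIdempotent_eq [DecidableEq X] (i : Fin (d + 1)) :
    S.dualIdempotent k x i = Matrix.diagonal fun y => if S.color x y = i then 1 else 0 := by
  simp only [dualIdempotent, mem_R_iff]

variable [Fintype X] [DecidableEq X]

theorem adjacencyMatrix_mem (i : Fin (d + 1)) :
    S.adjacencyMatrix k i ∈ S.terwilligerAlgebra k x :=
  Algebra.subset_adjoin (Or.inl ⟨i, rfl⟩)

theorem dualIdempotent_mem (i : Fin (d + 1)) :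
    S.dualIdempotent k x i ∈ S.terwilligerAlgebra k x :=
  Algebra.subset_adjoin (Or.inr ⟨i, rfl⟩)

theorem dualIdempotent_mul_apply (i : Fin (d + 1)) (M : Matrix X X k) (y z : X) :
    (S.dualIdempotent k x i * M) y z = if S.color x y = i then M y z else 0 := by
  rw [dualIdempotent_eq, Matrix.diagonal_mul]; simp

theorem mul_dualIdempotent_apply (i : Fin (d + 1)) (M : Matrix X X k) (y z : X) :
    (M * S.dualIdempotent k x i) y z = if S.color x z = i then M y z else 0 := by
  rw [dualIdempotent_eq, Matrix.mul_diagonal]; simp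

theorem transpose_mem {M : Matrix X X k} (hM : M ∈ S.terwilligerAlgebra k x) :
    M.transpose ∈ S.terwilligerAlgebra k x := by
  induction hM using Algebra.adjoin_induction with
  | mem M hM =>
    rcases hM with ⟨i, rfl⟩ | ⟨i, rfl⟩
    · convert S.adjacencyMatrix_mem k x (S.inv i) using 1
      ext y z
      simp only [Matrix.transpose_apply, adjacencyMatrix_apply, color_eq_inv_iff]
    · rw [dualIdempotent_eq, Matrix.diagonal_transpose, ← dualIdempotent_eq]
      exact S.dualIdempotent_mem k x i
  | algebraMap r =>
    rw [Matrix.algebraMap_eq_diagonal, Matrix.diagonal_transpose, ← Matrix.algebraMap_eq_diagonal]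
    exact Subalgebra.algebraMap_mem _ r
  | add M N _ _ hM hN => rw [Matrix.transpose_add]; exact add_mem hM hN
  | mul M N _ _ hM hN => rw [Matrix.transpose_mul]; exact mul_mem hN hM

/-- The matrix supported in the column of `x` whose entry in a row `y` only depends on the class
of `y`. -/
theorem column_mem (f : Fin (d + 1) → k) :
    (Matrix.of fun y z => if z = x then f (S.color x y) else 0) ∈ S.terwilligerAlgebra k x := by
  have h : (Matrix.of fun y z => if z = x then f (S.color x y) else 0) =
      ∑ i, f i • (S.dualIdempotent k x i * (S.adjacencyMatrix k (S.inv i) *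
        S.dualIdempotent k x 0)) := by
    ext y z
    simp only [Matrix.sum_apply, Matrix.smul_apply, dualIdempotent_mul_apply,
      mul_dualIdempotent_apply, adjacencyMatrix_apply, color_eq_inv_iff, color_eq_zero_iff,
      smul_eq_mul, mul_ite, mul_one, mul_zero, Finset.sum_ite_eq, Finset.mem_univ, if_true,
      Matrix.of_apply, eq_comm (a := x)]
    by_cases hz : z = x
    · subst hz; simp
    · simp [hz]
  rw [h]
  refine sum_mem fun i _ => Subalgebra.smul_mem _ (mul_mem ?_ (mul_mem ?_ ?_)) _
  exacts [S.dualIdempotent_mem k x i, S.adjacencyMatrix_mem k x _, S.dualIdempotent_mem k x 0]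

theorem IsQuasiThin.apply_swap_swap {S : AssociationScheme X d} (hS : S.IsQuasiThin)
    {M : Matrix X X k} (hM : M ∈ S.terwilligerAlgebra k x) (y z : X) :
    M (S.swap x y) (S.swap x z) = M y z := by
  have hinj : Function.Involutive (S.swap x) := hS.swap_swap x
  induction hM using Algebra.adjoin_induction generalizing y z with
  | mem M hM =>
    rcases hM with ⟨i, rfl⟩ | ⟨i, rfl⟩
    · simp only [adjacencyMatrix_apply, hS.color_swap_swap]
    · simp only [dualIdempotent_eq, Matrix.diagonal_apply, hinj.injective.eq_iff,
        color_swap_right]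
  | algebraMap r =>
    simp only [Matrix.algebraMap_matrix_apply, hinj.injective.eq_iff]
  | add M N _ _ hM hN => simp only [Matrix.add_apply, hM, hN]
  | mul M N _ _ hM hN =>
    simp only [Matrix.mul_apply]
    rw [← Equiv.sum_comp hinj.toPerm]
    simp only [Function.Involutive.coe_toPerm, hM, hN]

theorem IsQuasiThin.swapMatrix_mem {S : AssociationScheme X d} (hS : S.IsQuasiThin) :
    (Matrix.of fun y z => if z = S.swap x y then 1 else 0) ∈ S.terwilligerAlgebra k x := by
  classical
  have hP (p : X) : (Matrix.of fun y z => if S.color x y = S.color x p ∧ z = S.swap x y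
      then 1 else 0) ∈ S.terwilligerAlgebra k x := by
    have h : (Matrix.of fun y z => if S.color x y = S.color x p ∧ z = S.swap x y
        then (1 : k) else 0) = S.dualIdempotent k x (S.color x p) *
          (S.adjacencyMatrix k (S.color p (S.swap x p)) * S.dualIdempotent k x (S.color x p)) := by
      ext y z
      simp only [Matrix.of_apply, dualIdempotent_mul_apply, mul_dualIdempotent_apply,
        adjacencyMatrix_apply]
      by_cases hy : S.color x y = S.color x p
      · by_cases hz : S.color x z = S.color x p
        · simp only [hy, hz, true_and, if_true, hS.color_self_swap_iff hy hz]
        · have : z ≠ S.swap x y := by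
            rintro rfl
            exact hz ((S.color_swap_right x y).trans hy)
          simp [hy, hz, this]
      · simp [hy]
    rw [h]
    exact mul_mem (S.dualIdempotent_mem k x _)
      (mul_mem (S.adjacencyMatrix_mem k x _) (S.dualIdempotent_mem k x _))
  have hQ (i : Fin (d + 1)) : (Matrix.of fun y z => if S.color x y = i ∧ z = S.swap x y
      then 1 else 0) ∈ S.terwilligerAlgebra k x := by
    by_cases h : ∃ p, S.color x p = i
    · obtain ⟨p, rfl⟩ := h
      exact hP p
    · push Not at h
      convert zero_mem (S.terwilligerAlgebra k x) using 1
      ext y z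
      simp [h]
  convert sum_mem fun i (_ : i ∈ Finset.univ) => hQ i using 1
  ext y z
  by_cases h : z = S.swap x y <;> simp [Matrix.sum_apply, h]

/-! ### Semisimplicity when 2 is invertible or the involution is trivial -/

theorem IsQuasiThin.eq_zero_of_mem_jacobson {S : AssociationScheme X d} (hS : S.IsQuasiThin)
    (M : S.terwilligerAlgebra k x) (hM : M ∈ Ring.jacobson (S.terwilligerAlgebra k x))
    {s : k} (hs : s * s = 1) (hsM : ∀ y z, M.1 (S.swap x y) z = s * M.1 y z)
    (h2 : (2 : k) ≠ 0 ∨ ∀ y, S.swap x y = y) : M = 0 := by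
  classical
  by_contra hne
  obtain ⟨p, q, hpq⟩ : ∃ p q, M.1 p q ≠ 0 := by
    by_contra! h
    exact hne (Subtype.ext (Matrix.ext h))
  set c := M.1 p q
  let E (y : X) : S.terwilligerAlgebra k x := ⟨_, S.dualIdempotent_mem k x (S.color x y)⟩
  let t : S.terwilligerAlgebra k x := ⟨_, S.transpose_mem k x (E p * M * E q).2⟩
  have hmem : t * (E p * M * E q) ∈ Ring.jacobson (S.terwilligerAlgebra k x) :=
    Ideal.mul_mem_left _ _ (Ideal.mul_mem_right _ _ (Ideal.mul_mem_left _ _ hM))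
  have hnil : IsNilpotent (t * (E p * M * E q)) := by
    have : IsArtinianRing (S.terwilligerAlgebra k x) := IsArtinianRing.of_finite k _
    obtain ⟨n, hn⟩ := IsSemiprimaryRing.isNilpotent (R := S.terwilligerAlgebra k x)
    have := Ideal.pow_mem_pow hmem n
    rw [hn] at this
    exact ⟨n, this⟩
  have htr := (Matrix.isNilpotent_trace_of_isNilpotent
    (hnil.map (S.terwilligerAlgebra k x).val)).eq_zero
  have hswap (y z : X) : M.1 y (S.swap x z) = s * M.1 y z := by
    rw [← hS.apply_swap_swap k x M.2, hS.swap_swap, hsM]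
  -- Within the block entries differ from `c` by powers of `s`; squaring removes these.
  have hsq (y z : X) : (E p * M * E q).1 y z * (E p * M * E q).1 y z =
      (if S.color x y = S.color x p then 1 else 0) *
        (if S.color x z = S.color x q then 1 else 0) * (c * c) := by
    have : (E p * M * E q).1 y z = if S.color x z = S.color x q then
        if S.color x y = S.color x p then M.1 y z else 0 else 0 := by
      simp only [MulMemClass.coe_mul, E, mul_dualIdempotent_apply, dualIdempotent_mul_apply]
    rw [this]
    split_ifs with h1 h2 <;> simp only [mul_zero, zero_mul, one_mul]
    have hs' (u : k) : s * u * (s * u) = u * u := by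
      rw [mul_mul_mul_comm, hs, one_mul]
    rcases hS.eq_or_eq_swap h1 with rfl | rfl <;> rcases hS.eq_or_eq_swap h2 with rfl | rfl <;>
      simp only [hsM, hswap, hs', c]
  have hcard (y : X) : (∑ z, if S.color x z = S.color x y then (1 : k) else 0) ≠ 0 := by
    simp only [hS.color_eq_iff, Finset.sum_boole]
    have : (Finset.univ.filter fun z => z = y ∨ z = S.swap x y) = {y, S.swap x y} := by
      ext; simp
    rw [this]
    by_cases h : S.swap x y = y
    · simp [h]
    · rw [Finset.card_pair (Ne.symm h)]
      exact_mod_cast h2.resolve_right fun h' => h (h' y)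
  -- The trace of NᵀN is the sum of the squares of the entries of N.
  have : (∑ z, ∑ y, (E p * M * E q).1 y z * (E p * M * E q).1 y z) = 0 := by
    rw [← htr]
    rfl
  simp only [hsq, ← Finset.sum_mul, ← Finset.mul_sum] at this
  exact mul_ne_zero (mul_ne_zero (hcard p) (hcard q)) (mul_ne_zero hpq hpq) this

/-- For `M` in the radical, the eigenparts `M ± σ * M` are also radical, and their sum is `2 • M`.
-/
theorem IsQuasiThin.isSemisimpleRing {S : AssociationScheme X d} (hS : S.IsQuasiThin)
    (h2 : (2 : k) ≠ 0 ∨ ∀ y, S.swap x y = y) : IsSemisimpleRing (S.terwilligerAlgebra k x) := by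
  have : IsArtinianRing (S.terwilligerAlgebra k x) := IsArtinianRing.of_finite k _
  rw [IsArtinianRing.isSemisimpleRing_iff_jacobson, eq_bot_iff]
  intro M hM
  by_cases hid : ∀ y, S.swap x y = y
  · exact hS.eq_zero_of_mem_jacobson k x M hM (mul_one 1) (by simp [hid]) h2
  have h2' := h2.resolve_right hid
  let σ : S.terwilligerAlgebra k x := ⟨_, hS.swapMatrix_mem k x⟩
  have hσ (y z : X) : (σ * M).1 y z = M.1 (S.swap x y) z := by
    simp [σ, Matrix.mul_apply]
  have hadd := hS.eq_zero_of_mem_jacobson k x (M + σ * M)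
    (add_mem hM (Ideal.mul_mem_left _ _ hM)) (mul_one 1) (fun y z => by
      simp only [AddMemClass.coe_add, Matrix.add_apply, hσ, hS.swap_swap]; ring) h2
  have hsub := hS.eq_zero_of_mem_jacobson k x (M - σ * M)
    (sub_mem hM (Ideal.mul_mem_left _ _ hM)) (s := -1) (by ring) (fun y z => by
      simp only [AddSubgroupClass.coe_sub, Matrix.sub_apply, hσ, hS.swap_swap]; ring) h2
  have h : (2 : k) • M = 0 := by
    rw [two_smul]
    calc M + M = (M + σ * M) + (M - σ * M) := by abel
      _ = 0 := by rw [hadd, hsub, add_zero]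
  exact (smul_eq_zero.mp h).resolve_left h2'

/-! ### Finite dominant dimension in characteristic 2 -/

theorem IsQuasiThin.dominantDimension_ne_top {S : AssociationScheme X d} (hS : S.IsQuasiThin)
    (h2 : (2 : k) = 0) {p : X} (hp : S.swap x p ≠ p) :
    dominantDimension (S.terwilligerAlgebra k x) ≠ ⊤ := by
  classical
  have hsum (g : X → k) : (∑ z, if S.color x z = S.color x p then g z else 0) =
      g p + g (S.swap x p) := by
    rw [← Finset.sum_filter]
    have : (Finset.univ.filter fun z => S.color x z = S.color x p) = {p, S.swap x p} := by
      ext; simp [hS.color_eq_iff]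
    rw [this, Finset.sum_pair hp.symm]
  let aM : Matrix X X k := Matrix.of fun y z => if z = x then
    if S.color x y = S.color x p then 1 else 0 else 0
  have ha : aM ∈ S.terwilligerAlgebra k x :=
    S.column_mem k x fun i => if i = S.color x p then 1 else 0
  let a : S.terwilligerAlgebra k x := ⟨aM, ha⟩
  let b : S.terwilligerAlgebra k x := ⟨aM.transpose, S.transpose_mem k x ha⟩
  let e : S.terwilligerAlgebra k x := ⟨_, S.dualIdempotent_mem k x 0⟩
  let f : S.terwilligerAlgebra k x := ⟨_, S.dualIdempotent_mem k x (S.color x p)⟩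
  have hya (y : S.terwilligerAlgebra k x) (u v : X) :
      (y * a).1 u v = if v = x then y.1 u p + y.1 u (S.swap x p) else 0 := by
    rw [← hsum]
    by_cases hv : v = x <;> simp [a, aM, Matrix.mul_apply, hv]
  have hyb (y : S.terwilligerAlgebra k x) (u v : X) :
      (y * b).1 u v = if S.color x v = S.color x p then y.1 u x else 0 := by
    simp [b, aM, Matrix.mul_apply]
  have hay (y : S.terwilligerAlgebra k x) (u v : X) :
      (a * y).1 u v = if S.color x u = S.color x p then y.1 x v else 0 := by
    simp [a, aM, Matrix.mul_apply]
  have hye (y : S.terwilligerAlgebra k x) (u v : X) :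
      (y * e).1 u v = if x = v then y.1 u v else 0 := by
    simp only [MulMemClass.coe_mul, e, mul_dualIdempotent_apply, color_eq_zero_iff]
  have hey (y : S.terwilligerAlgebra k x) (u v : X) :
      (e * y).1 u v = if x = u then y.1 u v else 0 := by
    simp only [MulMemClass.coe_mul, e, dualIdempotent_mul_apply, color_eq_zero_iff]
  have hyf (y : S.terwilligerAlgebra k x) (u v : X) :
      (y * f).1 u v = if S.color x v = S.color x p then y.1 u v else 0 := by
    simp only [MulMemClass.coe_mul, f, mul_dualIdempotent_apply]
  -- As the swap fixes `x`, column `x` of `s` takes equal values at `p` and `swap x p`; they cancel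
  -- in characteristic 2. This gives both `b * a = 0` and `b * s ≠ e`.
  have hbx (s : S.terwilligerAlgebra k x) : (b * s).1 x x = 0 := by
    have h : (b * s).1 x x = s.1 p x + s.1 (S.swap x p) x := by
      rw [← hsum fun z => s.1 z x]
      simp [b, aM, Matrix.mul_apply]
    have h' : s.1 (S.swap x p) x = s.1 p x := by
      rw [← hS.apply_swap_swap k x s.2 p x, S.swap_self]
    rw [h, h', ← two_mul, h2, zero_mul]
  refine _root_.dominantDimension_ne_top fun P =>
    P.not_projective_two (e := e) (f := f) (a := a) (b := b) ?_ ?_ ?_ ?_ ?_ ?_ ?_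
  · ext u v
    rw [hye]
    by_cases hv : v = x <;> simp [a, aM, hv, eq_comm (a := x)]
  · ext u v
    rw [hyf]
    by_cases hv : S.color x v = S.color x p <;> simp [b, aM, hv]
  · ext u v
    by_cases hu : u = x
    · subst hu
      rw [hya]
      split_ifs with hv
      · subst hv
        have := hbx a
        rw [hya, if_pos rfl] at this
        exact this
      · rfl
    · simp [b, aM, hu, Matrix.mul_apply]
  · intro y hy
    ext u v
    rw [hye]
    split_ifs with h
    · subst h
      have := hyb y u p
      rw [hy, if_pos rfl] at this
      exact this.symm
    · rfl
  · intro y hy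
    have hyp (u : X) : y.1 u p = y.1 u (S.swap x p) := by
      have := hya y u x
      rw [hy, if_pos rfl] at this
      have h0 : y.1 u p + y.1 u (S.swap x p) = 0 := this.symm
      linear_combination h0 - y.1 u (S.swap x p) * h2
    -- By invariance and `hyp`, column `p` of `y` is constant on classes, so moved to column `x` it
    -- is an element of the algebra, the required `z`.
    have hfac : Function.FactorsThrough (fun u => y.1 u p) (S.color x) := by
      intro u v huv
      rcases hS.eq_or_eq_swap huv with rfl | rfl
      · rfl
      · change y.1 (S.swap x v) p = y.1 v p
        rw [← hS.apply_swap_swap k x y.2, hS.swap_swap, hyp]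
    obtain ⟨g, hg⟩ := (Function.factorsThrough_iff _).mp hfac
    refine ⟨⟨_, S.column_mem k x g⟩, ?_⟩
    ext u v
    rw [hyf, hyb]
    have hgu : y.1 u p = g (S.color x u) := congrFun hg u
    split_ifs with hv
    · simp only [Matrix.of_apply, if_true, ← hgu]
      rcases hS.eq_or_eq_swap hv with rfl | rfl
      exacts [rfl, (hyp u).symm]
    · rfl
  · intro y hy
    ext u v
    rw [hey]
    split_ifs with h
    · subst h
      have := hay y p v
      rw [hy, if_pos rfl] at this
      exact this.symm
    · rfl
  · intro s hs
    have := hbx s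
    rw [hs] at this
    simp [e, dualIdempotent_eq, (S.color_eq_zero_iff x x).mpr rfl] at this

end Terwilliger
end AssociationScheme

theorem corollary2p13 {k : Type*} [Field k] {X : Type*} [Fintype X] [DecidableEq X] {d : ℕ}
    (S : AssociationScheme X d) (hS : S.IsQuasiThin) (x : X)
    (hdom : dominantDimension (S.terwilligerAlgebra k x) = ⊤) :
    Module.Injective (S.terwilligerAlgebra k x) (S.terwilligerAlgebra k x) ∧
      IsSemisimpleRing (S.terwilligerAlgebra k x) := by
  have : IsSemisimpleRing (S.terwilligerAlgebra k x) := by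
    refine hS.isSemisimpleRing k x ?_
    by_contra! h
    obtain ⟨h2, p, hp⟩ := h
    exact hS.dominantDimension_ne_top k x h2 hp hdom
  exact ⟨Module.injective_of_isSemisimpleRing _ _, this⟩
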